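/- Let $G$ be a finite tree rooted at a vertex $r$. The level of a vertex is $1$ plus its distance from $r$, and the children of a vertex $v$ are the neighbours of $v$ whose level exceeds that of $v$ by one. For integers $d \ge 2$ and $k \ge 1$, the Bethe tree $\mathcal{B}_{d,k}$ is the rooted tree which has exactly $k$ levels (so that the root has eccentricity $k-1$) and in which each vertex has exactly $d-1$ children, except for the vertices on level $k$, which have none. The energy $\mathcal{E}(G)$ of a finite simple graph $G$ is the sum of the absolute values of all the eigenvalues of its adjacency matrix, counted with multiplicity. For every Bethe tree $\mathcal{B}_{d,k}$ with $d \ge 3$ and $k \ge 1$ we have $$\mathcal{E}(\mathcal{B}_{d,k}) = \sum_{j=1}^{k-1} f_j\,(d-1)^{k-\frac12-j},$$ where $$f_j = \begin{cases} 2\csc\left(\dfrac{\pi}{2j+4}\right) - 2\cot\left(\dfrac{\pi}{2j+2}\right), & j \text{ odd},\\[2mm] 2\cot\left(\dfrac{\pi}{2j+4}\right) - 2\csc\left(\dfrac{\pi}{2j+2}\right), & j \text{ even}.\end{cases}$$ Also, for every $k \ge 1$, $$\mathcal{E}(\mathcal{B}_{2,k}) = \begin{cases} 2\left(\cot\left(\dfrac{\pi}{2k+2}\right)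 - 1\right), & k \text{ odd},\\[2mm] 2\left(\csc\left(\dfrac{\pi}{2k+2}\right) - 1\right), & k \text{ even}.\end{cases}$$ -/

import Mathlib

namespace BetheEnergy

/-- The energy of a finite simple graph: the sum of the absolute values of all the eigenvalues of
its adjacency matrix, counted with multiplicity. -/
noncomputable def energy {V : Type*} [Fintype V] [DecidableEq V] (G : SimpleGraph V)
    [DecidableRel G.Adj] : ℝ :=
  ∑ i, |Matrix.IsHermitian.eigenvalues (A := G.adjMatrix ℝ)
    (by rw [Matrix.IsHermitian, Matrix.conjTranspose_eq_transpose_of_trivial];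
        exact G.isSymm_adjMatrix) i|

/-- The level of a vertex `v` in a tree `G` rooted at `r`; the root is on level `1`. -/
noncomputable def level {V : Type*} (G : SimpleGraph V) (r v : V) : ℕ :=
  G.dist r v + 1

/-- The set of children of a vertex `v` in a tree `G` rooted at `r`. -/
def children {V : Type*} (G : SimpleGraph V) (r v : V) : Set V :=
  {w | G.Adj v w ∧ level G r w = level G r v + 1}

/-- `G`, rooted at `r`, is a Bethe tree `B_{d,k}`: a rooted tree with exactly `k` levels (that is,
the root has eccentricity `k - 1`) in which every vertex has exactly `d - 1` children, besides the
vertices on the last level, which have none. (Such a tree is automatically balanced.) -/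
structure IsBetheTree {V : Type*} (G : SimpleGraph V) (r : V) (d k : ℕ) : Prop where
  isTree : G.IsTree
  eccent_add_one : G.eccent r + 1 = (k : ℕ∞)
  ncard_children : ∀ v, level G r v < k → (children G r v).ncard = d - 1
  children_last : ∀ v, level G r v = k → children G r v = ∅

/-- The cosecant. -/
noncomputable def csc (x : ℝ) : ℝ := 1 / Real.sin x

/-- The coefficients `f_j`. -/
noncomputable def f (j : ℕ) : ℝ :=
  if Odd j then 2 * csc (Real.pi / (2 * j + 4)) - 2 * Real.cot (Real.pi / (2 * j + 2))
  else 2 * Real.cot (Real.pi / (2 * j + 4)) - 2 * csc (Real.pi / (2 * j + 2))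

end BetheEnergy

namespace BetheEnergy

open Finset Polynomial

/-! ### Rooted trees and elimination from the leaves -/

section

variable {V : Type*} {G : SimpleGraph V}

/-! Eliminating from the leaves upwards factors `x - A` for a tree as a unitriangular matrix times a
diagonal one times the transpose, so the determinant is the product of the pivots
(`det_sub_adjMatrix`). In a Bethe tree the pivot depends only on the height above the bottom: `b 0 =
x` and `b (n + 1) = x - (d - 1) / b n`. With `s = √(d - 1)` and `x = 2 s t` the Chebyshev recursion
solves this by `b n = s U_{n+1}(t) / U_n(t)`.

Height `n` carries `(d - 1) ^ (k - 1 - n)` vertices, so the spectrum scaled by `1 / (2 s)` is, with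
multiplicities, a combination of the root sets of the `U_n`. Since `U_n(x / 2)` is the
characteristic polynomial of the path with `n` vertices, the energy is `s` times the sum of `(d - 1)
^ (k - 1 - n) (E(P_{n+1}) - E(P_n))`, and these differences are the `f n`. For `d = 2` the sum
telescopes. -/

theorem dist_eq_of_level {r v w : V} :
    level G r w = level G r v + 1 ↔ G.dist r w = G.dist r v + 1 := by
  simp [level]

/-- In a tree, every vertex is a child of at most one vertex. -/
theorem parent_unique (hG : G.IsTree) {r u v w : V} (hu : w ∈ children G r u)
    (hv : w ∈ children G r v) : u = v := by
  have key : ∀ u, w ∈ children G r u →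
      ∃ p : G.Walk r w, p.IsPath ∧ p.penultimate = u := by
    rintro u ⟨hadj, hl⟩
    rw [dist_eq_of_level] at hl
    obtain ⟨p, hp⟩ := hG.connected.exists_walk_length_eq_dist r u
    refine ⟨p.concat hadj, SimpleGraph.Walk.isPath_of_length_eq_dist _ ?_, by simp⟩
    rw [SimpleGraph.Walk.length_concat, hp, hl]
  obtain ⟨p, hp, rfl⟩ := key u hu
  obtain ⟨q, hq, rfl⟩ := key v hv
  rw [(hG.existsUnique_path r w).unique hp hq]

/-- In a connected graph, every vertex besides the root is a child. -/
theorem exists_parent (hG : G.Connected) {r w : V} {n : ℕ} (hw : G.dist r w = n + 1) :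
    ∃ v, G.dist r v = n ∧ w ∈ children G r v := by
  obtain ⟨p, hp⟩ := hG.exists_walk_length_eq_dist r w
  have hnil : ¬ p.Nil := by
    rw [← SimpleGraph.Walk.length_eq_zero_iff]; omega
  have hadj := p.adj_penultimate hnil
  have h1 : G.dist r p.penultimate ≤ n := by
    refine (SimpleGraph.dist_le p.dropLast).trans ?_
    have := p.length_dropLast_add_one hnil
    omega
  have h2 : G.dist r w ≤ G.dist r p.penultimate + 1 := by
    have := hG.dist_triangle (u := r) (v := p.penultimate) (w := w)
    rwa [SimpleGraph.dist_eq_one_iff_adj.2 hadj] at this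
  refine ⟨p.penultimate, by omega, hadj, ?_⟩
  rw [dist_eq_of_level]; omega

open Classical in
/-- The matrix whose entry at `(v, c)` is `1` if `c` is a child of `v`, and `0` otherwise. -/
noncomputable def childMatrix (G : SimpleGraph V) (r : V) : Matrix V V ℝ :=
  Matrix.of fun v c => if c ∈ children G r v then 1 else 0

theorem adjMatrix_eq_childMatrix_add (hG : G.IsTree) [DecidableRel G.Adj] (r : V) :
    G.adjMatrix ℝ = childMatrix G r + (childMatrix G r).transpose := by
  classical
  ext v w
  simp only [SimpleGraph.adjMatrix_apply, childMatrix, children, Matrix.add_apply,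
    Matrix.transpose_apply, Matrix.of_apply, Set.mem_ofPred_eq, dist_eq_of_level, G.adj_comm w v]
  by_cases h : G.Adj v w
  · rcases hG.dist_eq_dist_add_one_of_adj r h with h' | h'
    · simp [h, h']
      omega
    · simp [h, h']
      omega
  · simp [h]

variable [Fintype V] [DecidableEq V]

/-- Children lie strictly farther from the root, so ordering by distance makes the matrix
unitriangular. -/
theorem det_one_sub_childMatrix_mul (r : V) (w : V → ℝ) :
    (1 - childMatrix G r * Matrix.diagonal w).det = 1 := by
  classical
  have hent : ∀ v c, c ∉ children G r v → v ≠ c →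
      (1 - childMatrix G r * Matrix.diagonal w) v c = 0 := by
    intro v c h hne
    simp [childMatrix, h, Matrix.one_apply_ne hne]
  have hM : (1 - childMatrix G r * Matrix.diagonal w).BlockTriangular (G.dist r) := by
    intro v c h
    refine hent v c (fun hc => ?_) (by rintro rfl; exact lt_irrefl _ h)
    have := dist_eq_of_level.1 hc.2
    omega
  rw [hM.det]
  refine Finset.prod_eq_one fun a _ => ?_
  have : (1 - childMatrix G r * Matrix.diagonal w).toSquareBlock (G.dist r) a = 1 := by
    ext ⟨v, hv⟩ ⟨c, hc⟩
    have hn : c ∉ children G r v := by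
      intro h
      have := dist_eq_of_level.1 h.2
      omega
    by_cases h : v = c
    · subst h
      simp [Matrix.toSquareBlock_def, childMatrix, hn]
    · rw [Matrix.one_apply_ne (by simpa using h)]
      exact hent v c hn h
  rw [this, Matrix.det_one]

-- An off-diagonal entry sums over common children of two distinct vertices, and there are none.
open Classical in
theorem childMatrix_mul_diagonal_mul_transpose (hG : G.IsTree) (r : V) (w : V → ℝ) :
    childMatrix G r * Matrix.diagonal w * (childMatrix G r).transpose =
      Matrix.diagonal fun v => ∑ c with c ∈ children G r v, w c := by
  ext u v
  rw [Matrix.mul_apply]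
  simp only [Matrix.mul_diagonal, Matrix.transpose_apply, childMatrix, Matrix.of_apply,
    Matrix.diagonal_apply]
  split_ifs with h
  · subst h
    rw [Finset.sum_filter]
    refine Finset.sum_congr rfl fun c _ => ?_
    split_ifs <;> simp
  · refine Finset.sum_eq_zero fun c _ => ?_
    by_cases hu : c ∈ children G r u
    · have : c ∉ children G r v := fun hv => h (parent_unique hG hu hv)
      simp [this]
    · simp [hu]

open Classical in
/-- Gaussian elimination from the leaves of a tree upwards. -/
theorem det_sub_adjMatrix (hG : G.IsTree) [DecidableRel G.Adj] (r : V) (x : ℝ) (a : V → ℝ)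
    (ha : ∀ v, a v ≠ 0) (hx : ∀ v, x = a v + ∑ c with c ∈ children G r v, (a c)⁻¹) :
    (Matrix.scalar V x - G.adjMatrix ℝ).det = ∏ v, a v := by
  set P := childMatrix G r
  set D := Matrix.diagonal a
  set W := Matrix.diagonal fun v => (a v)⁻¹
  have hWD : W * D = 1 := by
    simp [W, D, Matrix.diagonal_mul_diagonal, ha]
  have hDW : D * W = 1 := by
    simp [W, D, Matrix.diagonal_mul_diagonal, ha]
  have hWt : W.transpose = W := Matrix.diagonal_transpose _
  have hP : P * W * P.transpose = _ := childMatrix_mul_diagonal_mul_transpose hG r _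
  have hscalar : Matrix.scalar V x = D + P * W * P.transpose := by
    rw [hP, Matrix.diagonal_add]
    simp only [Matrix.scalar_apply]
    congr 1
    funext v
    exact hx v
  -- As `W` inverts `D`, the cross terms collapse to `-P` and `-Pᵀ`, and the last term to `P W Pᵀ`.
  have hfac : Matrix.scalar V x - G.adjMatrix ℝ = (1 - P * W) * D * (1 - P * W).transpose := by
    rw [hscalar, adjMatrix_eq_childMatrix_add hG r, Matrix.transpose_sub, Matrix.transpose_one,
      Matrix.transpose_mul, hWt, sub_mul, Matrix.mul_assoc P W D, hWD, one_mul, mul_one,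
      sub_mul, mul_sub, mul_sub, mul_one, mul_one, ← mul_assoc D W, hDW, one_mul, mul_assoc]
    abel
  rw [hfac, Matrix.det_mul, Matrix.det_mul, Matrix.det_transpose, det_one_sub_childMatrix_mul]
  simp [D, Matrix.det_diagonal]

/-! ### Bethe trees: level sizes and pivots -/

omit [Fintype V] [DecidableEq V] in
theorem IsBetheTree.dist_lt {r : V} {d k : ℕ} (h : IsBetheTree G r d k) (v : V) :
    G.dist r v < k := by
  have h1 : G.edist r v + 1 ≤ (k : ℕ∞) := by
    rw [← h.eccent_add_one]
    gcongr
    exact SimpleGraph.edist_le_eccent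
  rw [← (h.isTree.connected r v).coe_dist_eq_edist] at h1
  exact_mod_cast h1

/-- Each level is the disjoint union of the child sets of the level above it. -/
theorem IsBetheTree.card_level {r : V} {d k : ℕ} (h : IsBetheTree G r d k) (n : ℕ) (hn : n < k) :
    #{v | G.dist r v = n} = (d - 1) ^ n := by
  classical
  induction n with
  | zero =>
    rw [pow_zero, Finset.card_eq_one]
    refine ⟨r, ?_⟩
    ext v
    simp [h.isTree.connected.dist_eq_zero_iff, eq_comm]
  | succ n ih =>
    have hU : ({v | G.dist r v = n + 1} : Finset V) =
        ({v | G.dist r v = n} : Finset V).biUnion fun v => {c | c ∈ children G r v} := by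
      ext w
      simp only [mem_filter, mem_univ, true_and, mem_biUnion]
      refine ⟨fun hw => exists_parent h.isTree.connected hw, ?_⟩
      rintro ⟨v, rfl, hv⟩
      exact dist_eq_of_level.1 hv.2
    rw [hU, Finset.card_biUnion, Finset.sum_congr rfl (g := fun _ => d - 1), Finset.sum_const,
      ih (by omega), smul_eq_mul, pow_succ]
    · intro v hv
      rw [← h.ncard_children v (by simp only [level]; simp at hv; omega),
        Set.ncard_eq_toFinset_card']
      congr 1
      ext; simp
    · intro u _ v _ huv
      rw [Function.onFun, Finset.disjoint_left]
      intro c hu hv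
      simp only [mem_filter, mem_univ, true_and] at hu hv
      exact huv (parent_unique h.isTree hu hv)

/-- The characteristic polynomial of a Bethe tree at a point `x`, in terms of the pivots `b h` of the
vertices that are `h` levels above the bottom. -/
theorem IsBetheTree.det_sub_adjMatrix {r : V} {d k : ℕ} (h : IsBetheTree G r d k)
    [DecidableRel G.Adj] (x : ℝ) (b : ℕ → ℝ) (hb : ∀ n < k, b n ≠ 0) (hb0 : b 0 = x)
    (hb1 : ∀ n, n + 1 < k → x = b (n + 1) + (d - 1 : ℕ) * (b n)⁻¹) :
    (Matrix.scalar V x - G.adjMatrix ℝ).det = ∏ n ∈ range k, b (k - 1 - n) ^ (d - 1) ^ n := by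
  classical
  rw [BetheEnergy.det_sub_adjMatrix h.isTree r x (fun v => b (k - 1 - G.dist r v))]
  · rw [← Finset.prod_fiberwise_of_maps_to (s := univ) (t := range k) (g := G.dist r)
      (fun v _ => mem_range.2 (h.dist_lt v))]
    refine Finset.prod_congr rfl fun n hn => ?_
    rw [← h.card_level n (mem_range.1 hn)]
    refine Finset.prod_eq_pow_card fun v hv => ?_
    rw [(mem_filter.1 hv).2]
  · intro v
    have := h.dist_lt v
    exact hb _ (by omega)
  · intro v
    have hv := h.dist_lt v
    rcases Nat.lt_or_ge (G.dist r v + 1) k with hlt | hge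
    · have hc : ∀ c ∈ ({c | c ∈ children G r v} : Finset V),
          (b (k - 1 - G.dist r c))⁻¹ = (b (k - 2 - G.dist r v))⁻¹ := by
        intro c hc
        have := dist_eq_of_level.1 (mem_filter.1 hc).2.2
        rw [this]
        congr 2
        omega
      have hcard : #{c | c ∈ children G r v} = d - 1 := by
        rw [← h.ncard_children v hlt, Set.ncard_eq_toFinset_card']
        congr 1
        ext; simp
      rw [Finset.sum_congr rfl hc, Finset.sum_const, hcard, nsmul_eq_mul,
        show k - 1 - G.dist r v = (k - 2 - G.dist r v) + 1 by omega]
      exact hb1 _ (by omega)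
    · have he : children G r v = ∅ := h.children_last v (by simp only [level]; omega)
      simp [he, ← hb0, show k - 1 - G.dist r v = 0 by omega]

end

/-! ### Cosine sums and path energies -/

theorem two_sin_mul_sum_cos (θ : ℝ) (m : ℕ) :
    2 * Real.sin (θ / 2) * ∑ i ∈ range m, Real.cos ((i + 1) * θ) =
      Real.sin ((2 * m + 1) * θ / 2) - Real.sin (θ / 2) := by
  induction m with
  | zero => simp
  | succ m ih =>
    rw [sum_range_succ, mul_add, ih]
    have h1 : ((2 * (m + 1 : ℕ) + 1) * θ / 2 : ℝ) = (m + 1) * θ + θ / 2 := by push_cast; ring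
    have h2 : ((2 * m + 1) * θ / 2 : ℝ) = (m + 1) * θ - θ / 2 := by ring
    rw [h1, h2, Real.sin_add, Real.sin_sub]
    ring

theorem sum_abs_cos_range (θ : ℝ) (m : ℕ) (h0 : 0 ≤ θ) (h : m * θ ≤ Real.pi / 2) :
    ∑ i ∈ range m, |Real.cos ((i + 1) * θ)| = ∑ i ∈ range m, Real.cos ((i + 1) * θ) := by
  refine sum_congr rfl fun i hi => abs_of_nonneg (Real.cos_nonneg_of_mem_Icc ⟨?_, ?_⟩)
  · have := Real.pi_pos
    have : 0 ≤ (i + 1) * θ := by positivity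
    linarith
  · have : (i + 1 : ℝ) ≤ m := by exact_mod_cast mem_range.1 hi
    exact (mul_le_mul_of_nonneg_right this h0).trans h

/-- The energy of a path with `j` vertices. -/
noncomputable def pathEnergy (j : ℕ) : ℝ :=
  if Odd j then 2 * (Real.cot (Real.pi / (2 * (j : ℝ) + 2)) - 1)
  else 2 * (csc (Real.pi / (2 * (j : ℝ) + 2)) - 1)

/-- The reflection `φ ↦ π - φ` preserves `|cos φ|`, so the sum is twice that over the angles below
`π / 2`, where cosines are positive and `two_sin_mul_sum_cos` applies. For odd `n` the middle angle
is `π / 2` and contributes nothing. -/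
theorem two_mul_sum_abs_cos (n : ℕ) :
    2 * ∑ i ∈ range n, |Real.cos ((i + 1) * Real.pi / (n + 1))| = pathEnergy n := by
  have hpi := Real.pi_pos
  set θ : ℝ := Real.pi / (n + 1) with hθ
  have hθ0 : 0 < θ := by positivity
  have hnθ : (n + 1) * θ = Real.pi := by rw [hθ]; field_simp
  have hsin : 0 < Real.sin (θ / 2) := by
    apply Real.sin_pos_of_pos_of_lt_pi (by positivity)
    nlinarith [(Nat.cast_nonneg n : (0 : ℝ) ≤ n)]
  have hterm : ∀ i : ℕ, (i + 1) * Real.pi / (n + 1) = (i + 1) * θ := fun i => by rw [hθ]; ring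
  have hang : Real.pi / (2 * (n : ℝ) + 2) = θ / 2 := by rw [hθ]; field_simp
  simp only [hterm, pathEnergy, hang]
  have hrefl : ∀ l m : ℕ, l + m = n →
      ∑ i ∈ range m, |Real.cos (((l + i : ℕ) + 1) * θ)| =
        ∑ i ∈ range m, |Real.cos ((i + 1) * θ)| := by
    intro l m hlm
    rw [← sum_range_reflect]
    refine sum_congr rfl fun i hi => ?_
    have hi := mem_range.1 hi
    have : ((l + (m - 1 - i) : ℕ) : ℝ) = n - 1 - i := by
      rw [show (n : ℝ) = (l + (m - 1 - i) : ℕ) + 1 + i by norm_cast; omega]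
      ring
    rw [this, show ((n : ℝ) - 1 - i + 1) * θ = Real.pi - (i + 1) * θ by rw [← hnθ]; ring,
      Real.cos_pi_sub, abs_neg]
  rcases Nat.even_or_odd' n with ⟨m, hm | hm⟩
  · have hnm : (n : ℝ) = 2 * m := by exact_mod_cast hm
    have hsum := two_sin_mul_sum_cos θ m
    rw [show (2 * m + 1) * θ / 2 = Real.pi / 2 by rw [← hnθ, hnm], Real.sin_pi_div_two] at hsum
    have : range n = range (m + m) := by rw [hm, two_mul]
    rw [if_neg (by rw [Nat.not_odd_iff_even, hm]; exact even_two_mul m), this, sum_range_add,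
      hrefl m m (by omega), sum_abs_cos_range θ m hθ0.le (by nlinarith), csc]
    generalize ∑ i ∈ range m, Real.cos ((i + 1) * θ) = S at hsum ⊢
    field_simp
    linarith
  · have hnm : (n : ℝ) = 2 * m + 1 := by exact_mod_cast hm
    have hsum := two_sin_mul_sum_cos θ m
    have hmid : ((m : ℝ) + 1) * θ = Real.pi / 2 := by rw [← hnθ, hnm]; ring
    rw [show (2 * m + 1) * θ / 2 = Real.pi / 2 - θ / 2 by rw [← hmid]; ring,
      Real.sin_pi_div_two_sub] at hsum
    have : range n = range ((m + 1) + m) := by rw [hm]; congr 1; omega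
    rw [if_pos (by rw [hm]; exact odd_two_mul_add_one m), this, sum_range_add,
      hrefl (m + 1) m (by omega), sum_range_succ, hmid, Real.cos_pi_div_two, abs_zero, add_zero,
      sum_abs_cos_range θ m hθ0.le (by nlinarith), Real.cot_eq_cos_div_sin]
    generalize ∑ i ∈ range m, Real.cos ((i + 1) * θ) = S at hsum ⊢
    field_simp
    linarith

theorem pathEnergy_one : pathEnergy 1 = 0 := by
  rw [← two_mul_sum_abs_cos]
  norm_num

theorem f_eq_sub (j : ℕ) : f j = pathEnergy (j + 1) - pathEnergy j := by
  have h : Real.pi / (2 * ((j + 1 : ℕ) : ℝ) + 2) = Real.pi / (2 * j + 4) := by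
    push_cast; ring_nf
  unfold f pathEnergy
  rw [h]
  by_cases hj : Odd j
  · rw [if_pos hj, if_pos hj, if_neg (by simpa [Nat.odd_add_one] using hj)]
    ring
  · rw [if_neg hj, if_neg hj, if_pos (by simpa [Nat.odd_add_one] using hj)]
    ring

/-! ### Root sums and Chebyshev polynomials -/

/-- The sum of the absolute values of the roots of a real polynomial, with multiplicity. -/
noncomputable def absRootSum (p : ℝ[X]) : ℝ := (p.roots.map abs).sum

theorem absRootSum_mul {p q : ℝ[X]} (h : p * q ≠ 0) :
    absRootSum (p * q) = absRootSum p + absRootSum q := by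
  simp [absRootSum, roots_mul h]

theorem absRootSum_pow (p : ℝ[X]) (n : ℕ) : absRootSum (p ^ n) = n * absRootSum p := by
  simp [absRootSum, Multiset.map_nsmul, Multiset.sum_nsmul]

theorem absRootSum_prod {ι : Type*} (s : Finset ι) (p : ι → ℝ[X]) (h : ∀ i ∈ s, p i ≠ 0) :
    absRootSum (∏ i ∈ s, p i) = ∑ i ∈ s, absRootSum (p i) := by
  classical
  induction s using Finset.induction_on with
  | empty => simp [absRootSum]
  | insert a s ha ih =>
    rw [prod_insert ha, sum_insert ha, absRootSum_mul, ih fun i hi => h i (mem_insert_of_mem hi)]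
    rw [← prod_insert ha]
    exact prod_ne_zero_iff.2 h

theorem two_mul_absRootSum_U (n : ℕ) : 2 * absRootSum (Chebyshev.U ℝ n) = pathEnergy n := by
  rw [← two_mul_sum_abs_cos, absRootSum, Chebyshev.roots_U_real, image_val_of_injOn,
    Multiset.map_map]
  · rfl
  · exact (Finset.range n).nodup_map_iff_injOn.mp (Chebyshev.roots_U_real_nodup n)

/-- Substituting `2 s X` divides every eigenvalue by `2 s`. -/
theorem energy_eq_absRootSum {V : Type*} [Fintype V] [DecidableEq V] (G : SimpleGraph V)
    [DecidableRel G.Adj] {s : ℝ} (hs : 0 < s) :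
    energy G = 2 * s * absRootSum ((G.adjMatrix ℝ).charpoly.comp (C (2 * s) * X)) := by
  have hH : (G.adjMatrix ℝ).IsHermitian := by
    rw [Matrix.IsHermitian, Matrix.conjTranspose_eq_transpose_of_trivial]
    exact G.isSymm_adjMatrix
  have h2 : 2 * s ≠ 0 := by positivity
  have hroots := (G.adjMatrix ℝ).charpoly.map_roots_comp_C_mul_X_add_C (2 * s) 0 h2.isUnit
  rw [hH.roots_charpoly_eq_eigenvalues, C_0, add_zero] at hroots
  have hE : energy G = ((univ.val.map (RCLike.ofReal ∘ hH.eigenvalues)).map (abs : ℝ → ℝ)).sum := by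
    rw [Multiset.map_map]
    rfl
  rw [hE, ← hroots, Multiset.map_map, absRootSum, ← Multiset.sum_map_mul_left]
  simp [abs_mul, abs_of_pos hs]

theorem U_ne_zero (n : ℕ) : Chebyshev.U ℝ n ≠ 0 := by
  intro h
  have := Chebyshev.U_eval_one ℝ n
  rw [h, eval_zero] at this
  have : (0 : ℝ) < n + 1 := by positivity
  simp_all

/-! ### The spectrum and energy of a Bethe tree -/

variable {V : Type*} [Fintype V] [DecidableEq V] {G : SimpleGraph V} [DecidableRel G.Adj]

/-- This is the product of the pivots `s U_{n+1} / U_n` with denominators cleared, so that it holds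
between polynomials and roots can be compared. -/
theorem IsBetheTree.charpoly_comp_mul_prod {r : V} {d k : ℕ} (h : IsBetheTree G r d k) {s : ℝ}
    (hs : 0 < s) (hsd : s * s = (d - 1 : ℕ)) :
    (G.adjMatrix ℝ).charpoly.comp (C (2 * s) * X) *
        ∏ n ∈ range k, Chebyshev.U ℝ n ^ (d - 1) ^ (k - 1 - n) =
      C (∏ n ∈ range k, s ^ (d - 1) ^ (k - 1 - n)) *
        ∏ n ∈ range k, Chebyshev.U ℝ (n + 1 : ℕ) ^ (d - 1) ^ (k - 1 - n) := by
  -- Multiplying both sides by all the `U_n` makes the identity trivial wherever a pivot is zero or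
  -- undefined.
  have hne : ∏ n ∈ range (k + 1), Chebyshev.U ℝ n ≠ 0 := prod_ne_zero_iff.2 fun n _ => U_ne_zero n
  refine mul_right_cancel₀ hne (Polynomial.funext fun t => ?_)
  rw [eval_mul, eval_mul (q := ∏ n ∈ range (k + 1), Chebyshev.U ℝ n)]
  by_cases ht : (∏ n ∈ range (k + 1), Chebyshev.U ℝ n).eval t = 0
  · rw [ht, mul_zero, mul_zero]
  congr 1
  rw [eval_prod, ← ne_eq, prod_ne_zero_iff] at ht
  set u : ℕ → ℝ := fun n => (Chebyshev.U ℝ n).eval t with hu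
  have hu0 : ∀ n ≤ k, u n ≠ 0 := fun n hn => ht n (mem_range.2 (by omega))
  have hdet := h.det_sub_adjMatrix (2 * s * t) (fun n => s * (u (n + 1) / u n))
    (fun n hn => mul_ne_zero hs.ne' (div_ne_zero (hu0 _ (by omega)) (hu0 _ (by omega))))
    (by simp [hu]; ring)
    (by
      intro n hn
      have h0 := hu0 n (by omega)
      have h1 := hu0 (n + 1) (by omega)
      have hrec : u (n + 2) = 2 * t * u (n + 1) - u n := by
        simp [hu, Chebyshev.U_add_two]
      rw [hrec, ← hsd]
      field_simp
      ring)
  -- Reindexes from distance to the root to height above the bottom.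
  rw [← prod_range_reflect] at hdet
  simp only [eval_mul, eval_prod, eval_pow, eval_C, eval_comp, eval_X, Matrix.eval_charpoly]
  rw [hdet, ← prod_mul_distrib, ← prod_mul_distrib]
  refine prod_congr rfl fun n hn => ?_
  have hn := mem_range.1 hn
  have h0 := hu0 n (by omega)
  rw [show k - 1 - (k - 1 - n) = n by omega, ← mul_pow, ← mul_pow, mul_assoc, div_mul_cancel₀ _ h0]

theorem IsBetheTree.energy_eq_sum_range {r : V} {d k : ℕ} (h : IsBetheTree G r d k) (hd : 2 ≤ d) :
    energy G = √(d - 1) * ∑ n ∈ range k, ((d : ℝ) - 1) ^ (k - 1 - n) * f n := by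
  have hd1 : ((d - 1 : ℕ) : ℝ) = d - 1 := by push_cast [show 1 ≤ d by omega]; ring
  have hd' : (0 : ℝ) < d - 1 := by rw [← hd1]; exact_mod_cast (by omega : 0 < d - 1)
  have hs : 0 < √((d : ℝ) - 1) := Real.sqrt_pos.2 hd'
  have hc : ∏ n ∈ range k, √((d : ℝ) - 1) ^ (d - 1) ^ (k - 1 - n) ≠ 0 := by positivity
  have hid := h.charpoly_comp_mul_prod hs (by rw [Real.mul_self_sqrt hd'.le, hd1])
  have hne : ∀ g : ℕ → ℕ, ∀ n ∈ range k,
      Chebyshev.U ℝ (g n : ℕ) ^ (d - 1) ^ (k - 1 - n) ≠ 0 := fun g n _ => pow_ne_zero _ (U_ne_zero _)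
  have hr0 : C (∏ n ∈ range k, √((d : ℝ) - 1) ^ (d - 1) ^ (k - 1 - n)) *
        ∏ n ∈ range k, Chebyshev.U ℝ (n + 1 : ℕ) ^ (d - 1) ^ (k - 1 - n) ≠ 0 :=
    mul_ne_zero (C_ne_zero.2 hc) (prod_ne_zero_iff.2 (hne (· + 1)))
  have hsum := congrArg absRootSum hid
  rw [absRootSum_mul (hid ▸ hr0), absRootSum_mul hr0, absRootSum_prod _ _ (hne (· + 1)),
    absRootSum_prod _ _ (hne fun n => n)] at hsum
  simp only [absRootSum_pow, Nat.cast_pow, hd1] at hsum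
  have hC : ∀ c : ℝ, absRootSum (C c) = 0 := fun c => by simp [absRootSum]
  rw [hC, zero_add] at hsum
  rw [energy_eq_absRootSum G hs, eq_sub_of_add_eq hsum, ← sum_sub_distrib, mul_comm 2, mul_assoc,
    mul_sum]
  congr 1
  refine sum_congr rfl fun n _ => ?_
  rw [f_eq_sub, ← two_mul_absRootSum_U, ← two_mul_absRootSum_U]
  ring

theorem pathEnergy_zero : pathEnergy 0 = 0 := by
  rw [← two_mul_sum_abs_cos]
  simp

end BetheEnergy

theorem mainTheorem5 {V : Type*} [Fintype V] [DecidableEq V] (G : SimpleGraph V)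
    [DecidableRel G.Adj] (r : V) (d k : ℕ) (hk : 1 ≤ k)
    (hG : BetheEnergy.IsBetheTree G r d k) :
    (3 ≤ d →
      BetheEnergy.energy G =
        ∑ j ∈ Finset.Icc 1 (k - 1),
          BetheEnergy.f j * ((d : ℝ) - 1) ^ ((k : ℝ) - 1 / 2 - (j : ℝ))) ∧
    (d = 2 →
      BetheEnergy.energy G =
        if Odd k then 2 * (Real.cot (Real.pi / (2 * (k : ℝ) + 2)) - 1)
        else 2 * (BetheEnergy.csc (Real.pi / (2 * (k : ℝ) + 2)) - 1)) := by
  constructor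
  · intro hd
    have hd' : (0 : ℝ) < d - 1 := by
      have : (3 : ℝ) ≤ d := by exact_mod_cast hd
      linarith
    have hIcc : Finset.Icc 1 (k - 1) = Finset.Ico 1 k := by ext; simp; omega
    -- Paths with zero or one vertex have no energy, so the sum may start at `j = 1`.
    have hf0 : BetheEnergy.f 0 = 0 := by
      rw [BetheEnergy.f_eq_sub, BetheEnergy.pathEnergy_zero, zero_add, BetheEnergy.pathEnergy_one,
        sub_zero]
    rw [hG.energy_eq_sum_range (by omega), Finset.range_eq_Ico, Finset.sum_eq_sum_Ico_succ_bot hk,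
      hf0, mul_zero, zero_add, zero_add, hIcc, Finset.mul_sum]
    refine Finset.sum_congr rfl fun j hj => ?_
    have hj := Finset.mem_Ico.1 hj
    -- The `1 / 2` is the factor `√(d - 1)`; the natural subtraction is exact because `j < k`.
    have hexp : (k : ℝ) - 1 / 2 - j = 1 / 2 + ((k - 1 - j : ℕ) : ℝ) := by
      rw [show (k : ℝ) = ((k - 1 - j : ℕ) : ℝ) + 1 + j by norm_cast; omega]
      ring
    rw [hexp, Real.rpow_add hd', Real.rpow_natCast, Real.sqrt_eq_rpow]
    ring
  · rintro rfl
    have hone : ((2 : ℕ) : ℝ) - 1 = 1 := by norm_num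
    simp only [hG.energy_eq_sum_range le_rfl, hone, Real.sqrt_one, one_pow, one_mul,
      BetheEnergy.f_eq_sub]
    rw [Finset.sum_range_sub, BetheEnergy.pathEnergy_zero, sub_zero, BetheEnergy.pathEnergy]
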